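/- Let $M$ be a non-empty, compact, connected (Hausdorff) surface of class $C^2$ with possibly empty boundary $\partial M$, and let $\psi:M\to\mathbb{R}^3$ be an immersion of class $C^2$ with a unit normal field (Gauss map) $N:M\to\mathbb{S}^2$ of class $C^1$. Let $H$ denote the mean curvature of $\psi$ with respect to $N$, that is, half the trace of the shape operator $-dN$. Let $0\le\lambda\le 1$ and $\mathbf{w}\in\mathbb{S}^2$, and suppose that $M$ is a $\lambda$-translator with density vector $\mathbf{w}$, that is, $$H(p)=\langle N_p,\mathbf{w}\rangle+\lambda\qquad\text{for all }p\in M.$$ Let $v\in\mathbb{S}^2$, let $\Pi=v^\perp=\{x\in\mathbb{R}^3:\langle x,v\rangle=0\}$, and suppose that $\psi(\partial M)\subset\Pi$. Write $\mathrm{int}(M)$ for the image under $\psi$ of the set of interior points $M\setminus\partial M$. If $|\langle v,\mathbf{w}\rangle|\ge\lambda$, then $$\mathrm{int}(M)\subset\{x\in\mathbb{R}^3:\ \mathrm{sign}(\langle v,\mathbf{w}\rangle)\,\langle x,v\rangle\le 0\},$$ where $\mathrm{sign}(0)=0$. Moreover, $\mathrm{int}(M)\cap\Pi\neq\emptyset$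 if and only if $M$ is planar (that is, $\psi(M)$ is contained in some affine plane) and $|\langle v,\mathbf{w}\rangle|=\lambda$. -/

import Mathlib

open scoped Manifold ContDiff

/-- Euclidean three-space. -/
abbrev E3 : Type := EuclideanSpace ℝ (Fin 3)

section Surface

variable {M : Type*} [TopologicalSpace M] [ChartedSpace (EuclideanHalfSpace 2) M]

/-- The value of the differential of `f : M → ℝ³` at `p` on the `i`-th coordinate vector of the
tangent plane `T_p M` of a surface with (possibly empty) boundary, i.e. the partial derivative
`∂ᵢ f (p)` in the preferred chart at `p`. -/
noncomputable def partialAt (f : M → E3) (p : M) (i : Fin 2) : E3 :=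
  mfderiv (𝓡∂ 2) 𝓘(ℝ, E3) f p
    (EuclideanSpace.single i (1 : ℝ) : EuclideanSpace ℝ (Fin 2))

/-- The matrix `gᵢⱼ = ⟨∂ᵢψ, ∂ⱼψ⟩` of the first fundamental form of `ψ` at `p`. -/
noncomputable def firstFundamentalForm (ψ : M → E3) (p : M) : Matrix (Fin 2) (Fin 2) ℝ :=
  Matrix.of fun i j => inner ℝ (partialAt ψ p i) (partialAt ψ p j)

/-- The matrix `hᵢⱼ = -⟨∂ᵢN, ∂ⱼψ⟩` of the second fundamental form of `ψ` at `p` with respect to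
the unit normal `N`. -/
noncomputable def secondFundamentalForm (ψ N : M → E3) (p : M) : Matrix (Fin 2) (Fin 2) ℝ :=
  Matrix.of fun i j => -inner ℝ (partialAt N p i) (partialAt ψ p j)

/-- The mean curvature `H = ½ tr (g⁻¹ h)`: half the trace of the shape operator `-dN`. For the
graph of `u` with upward normal `(-Du, 1) / √(1 + |Du|²)` it is `½ div (Du / √(1 + |Du|²))`. It
does not depend on coordinates when `ψ` is an immersion. -/
noncomputable def meanCurvature (ψ N : M → E3) (p : M) : ℝ :=
  (1 / 2 : ℝ) * ((firstFundamentalForm ψ p)⁻¹ * secondFundamentalForm ψ N p).trace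

/-- `ψ : M → ℝ³` is an immersed surface (with boundary) of class `C²`, oriented by the
Gauss map `N` (of class `C¹`). -/
structure IsOrientedImmersedSurface (ψ N : M → E3) : Prop where
  contMDiff : ContMDiff (𝓡∂ 2) 𝓘(ℝ, E3) 2 ψ
  injective_mfderiv : ∀ p : M, Function.Injective (mfderiv (𝓡∂ 2) 𝓘(ℝ, E3) ψ p)
  contMDiff_normal : ContMDiff (𝓡∂ 2) 𝓘(ℝ, E3) 1 N
  norm_normal : ∀ p : M, ‖N p‖ = 1
  normal_orthogonal : ∀ (p : M) (i : Fin 2), inner ℝ (N p) (partialAt ψ p i) = 0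

/-- The immersed surface `ψ : M → ℝ³` with Gauss map `N` is a `lam`-translator with density
vector `w`: `H(p) = ⟨N_p, w⟩ + lam` at every point. -/
structure IsLambdaTranslator (lam : ℝ) (w : E3) (ψ N : M → E3) : Prop
    extends IsOrientedImmersedSurface ψ N where
  meanCurvature_eq : ∀ p : M, meanCurvature ψ N p = inner ℝ (N p) w + lam

end Surface

/-- The plane `v^⊥` through the origin. -/
def planeOrtho (v : E3) : Set E3 := {x | inner ℝ x v = 0}

/-- A subset of `ℝ³` is planar if some affine plane contains it. -/
def IsPlanar (S : Set E3) : Prop :=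
  ∃ P : AffineSubspace ℝ E3, Module.finrank ℝ P.direction = 2 ∧ S ⊆ P

/-! Replacing `v` by `-v` if necessary, assume `⟪v, w⟫ ≥ lam`, and study the height `⟪ψ, v⟫`. If `F
∘ ψ` has a local maximum at an interior point, the gradient of `F` there is a multiple `μ N`, and
the tangential trace of the Hessian of `F` plus `2 H μ` is nonpositive. The translator equation
turns `2 H μ` into an expression in the gradient alone (`exists_frame_of_isLocalMax`). For `F = ⟪·,
v⟫` that expression is `2 (⟪v, w⟫ + lam ⟪v, N⟫) ≥ 0`, so the height is a subsolution. A Hopf barrier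
carried by the ambient space upgrades this to a strong maximum principle (`eventually_height_eq`): a
maximal height attained at an interior point is attained on a neighbourhood, hence everywhere by
connectedness. A constant height must be zero, because a compact surface lying in a plane reaches
its extreme tangential position only on its boundary (`height_eq_zero_of_const`). Thus the maximal
height is zero in all cases, including empty boundary. Interior contact makes the height identically
zero, and the second derivative test then gives `⟪v, w⟫ ≤ lam`. Conversely, planarity alone forces
zero height. -/

open Set Filter Topology

/-! ### Frames, mean curvature and the second derivative test -/

section Surface

variable {M : Type*} [TopologicalSpace M] [ChartedSpace (EuclideanHalfSpace 2) M]

/-- The differential of a space-valued map on a surface, with the tangent plane and the target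
identified with the model spaces. -/
noncomputable def surfaceDeriv (f : M → E3) (p : M) : EuclideanSpace ℝ (Fin 2) →L[ℝ] E3 :=
  mfderiv (𝓡∂ 2) 𝓘(ℝ, E3) f p

theorem euclideanSpace_two_eq (e : EuclideanSpace ℝ (Fin 2)) :
    e = e 0 • EuclideanSpace.single 0 (1 : ℝ) + e 1 • EuclideanSpace.single 1 (1 : ℝ) := by
  ext i; fin_cases i <;> simp

theorem surfaceDeriv_apply (f : M → E3) (p : M) (e : EuclideanSpace ℝ (Fin 2)) :
    surfaceDeriv f p e
      = e 0 • partialAt f p 0 + e 1 • partialAt f p 1 := by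
  conv_lhs => rw [euclideanSpace_two_eq e]
  rw [map_add, map_smul, map_smul]
  rfl

theorem inner_normal_surfaceDeriv {ψ N : M → E3} (hS : IsOrientedImmersedSurface ψ N) (p : M)
    (e : EuclideanSpace ℝ (Fin 2)) :
    inner ℝ (N p) (surfaceDeriv ψ p e) = 0 := by
  rw [surfaceDeriv_apply, inner_add_right, inner_smul_right, inner_smul_right,
    hS.normal_orthogonal, hS.normal_orthogonal]
  simp

theorem contDiffAt_comp_extChartAt_symm {n : ℕ∞ω} {f : M → E3} {p : M}
    (hp : (𝓡∂ 2).IsInteriorPoint p) (hf : ContMDiffAt (𝓡∂ 2) 𝓘(ℝ, E3) n f p) :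
    ContDiffAt ℝ n (f ∘ (extChartAt (𝓡∂ 2) p).symm) (extChartAt (𝓡∂ 2) p p) := by
  have h := (contMDiffAt_iff.1 hf).2
  simp only [extChartAt_model_space_eq_id, PartialEquiv.refl_coe, Function.id_comp] at h
  exact h.contDiffAt (range_mem_nhds_isInteriorPoint hp)

theorem surfaceDeriv_eq_fderiv {f : M → E3} {p : M}
    (hp : (𝓡∂ 2).IsInteriorPoint p) (hf : MDifferentiableAt (𝓡∂ 2) 𝓘(ℝ, E3) f p) :
    surfaceDeriv f p
      = fderiv ℝ (f ∘ (extChartAt (𝓡∂ 2) p).symm) (extChartAt (𝓡∂ 2) p p) := by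
  rw [surfaceDeriv, hf.mfderiv, fderivWithin_of_mem_nhds (range_mem_nhds_isInteriorPoint hp),
    writtenInExtChartAt, extChartAt_model_space_eq_id]
  rfl

theorem eventually_inner_normal_fderiv [IsManifold (𝓡∂ 2) 2 M] {ψ N : M → E3} (hS : IsOrientedImmersedSurface ψ N) {p : M}
    (hp : (𝓡∂ 2).IsInteriorPoint p) :
    ∀ᶠ x in 𝓝 (extChartAt (𝓡∂ 2) p p), ∀ e : EuclideanSpace ℝ (Fin 2),
      inner ℝ ((N ∘ (extChartAt (𝓡∂ 2) p).symm) x)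
        (fderiv ℝ (ψ ∘ (extChartAt (𝓡∂ 2) p).symm) x e) = 0 := by
  have h1 : interior (extChartAt (𝓡∂ 2) p).target ∈ 𝓝 (extChartAt (𝓡∂ 2) p p) :=
    isOpen_interior.mem_nhds (ModelWithCorners.isInteriorPoint_iff.1 hp)
  filter_upwards [h1] with x hx e
  have hx' := interior_subset hx
  have hr : range (𝓡∂ 2) ∈ 𝓝 x :=
    mem_of_superset (mem_interior_iff_mem_nhds.1 hx) (extChartAt_target_subset_range p)
  have : IsManifold (𝓡∂ 2) 1 M := IsManifold.of_le (n := 2) (by norm_num)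
  have hd : MDifferentiableAt 𝓘(ℝ, EuclideanSpace ℝ (Fin 2)) (𝓡∂ 2)
      (extChartAt (𝓡∂ 2) p).symm x :=
    (mdifferentiableWithinAt_extChartAt_symm hx').mdifferentiableAt hr
  have hψ : MDifferentiableAt (𝓡∂ 2) 𝓘(ℝ, E3) ψ ((extChartAt (𝓡∂ 2) p).symm x) :=
    hS.contMDiff.mdifferentiableAt (by norm_num)
  rw [← mfderiv_eq_fderiv, mfderiv_comp x hψ hd]
  exact inner_normal_surfaceDeriv hS _ _

/-- The columns of `E` form a `g`-orthonormal frame, so `E * Eᵀ` is the inverse of `g`; cyclicity of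
the trace does the rest. -/
theorem trace_inv_mul_eq_of_orthonormal {g h E : Matrix (Fin 2) (Fin 2) ℝ}
    (hE : E.transpose * g * E = 1) : (g⁻¹ * h).trace = (E.transpose * h * E).trace := by
  have h1 : E * E.transpose * g = 1 := by
    rw [Matrix.mul_assoc]; exact mul_eq_one_comm.1 hE
  rw [Matrix.inv_eq_left_inv h1, Matrix.mul_assoc, Matrix.trace_mul_comm]

theorem transpose_mul_mul_apply_of_bilin {V : Type*} [NormedAddCommGroup V] [InnerProductSpace ℝ V]
    (a b : Fin 2 → V) (e : Fin 2 → EuclideanSpace ℝ (Fin 2)) (i j : Fin 2) :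
    ((Matrix.of fun k l => e l k).transpose *
      (Matrix.of fun k l => (inner ℝ (a k) (b l) : ℝ)) *
      (Matrix.of fun k l => e l k)) i j =
      inner ℝ (e i 0 • a 0 + e i 1 • a 1) (e j 0 • b 0 + e j 1 • b 1) := by
  simp only [Matrix.mul_apply, Fin.sum_univ_two, Matrix.transpose_apply, Matrix.of_apply,
    inner_add_left, inner_add_right, inner_smul_left, inner_smul_right]
  simp
  ring

theorem meanCurvature_eq_of_orthonormal (ψ N : M → E3) (p : M)
    (e : Fin 2 → EuclideanSpace ℝ (Fin 2))
    (he : Orthonormal ℝ fun i =>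
      surfaceDeriv ψ p (e i)) :
    2 * meanCurvature ψ N p = -∑ i, inner ℝ
      (surfaceDeriv N p (e i))
      (surfaceDeriv ψ p (e i)) := by
  have hE : (Matrix.of fun k l => e l k).transpose * firstFundamentalForm ψ p *
      (Matrix.of fun k l => e l k) = 1 := by
    ext i j
    rw [firstFundamentalForm, transpose_mul_mul_apply_of_bilin (partialAt ψ p) (partialAt ψ p),
      ← surfaceDeriv_apply, ← surfaceDeriv_apply, Matrix.one_apply]
    exact orthonormal_iff_ite.1 he i j
  have hh : secondFundamentalForm ψ N p =
      Matrix.of fun i j => inner ℝ (-partialAt N p i) (partialAt ψ p j) := by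
    ext i j; simp [secondFundamentalForm]
  rw [meanCurvature, trace_inv_mul_eq_of_orthonormal hE, Matrix.trace, hh,
    ← Finset.sum_neg_distrib]
  simp only [Matrix.diag_apply]
  rw [← mul_assoc]
  norm_num only
  rw [one_mul]
  refine Finset.sum_congr rfl fun i _ => ?_
  rw [transpose_mul_mul_apply_of_bilin (fun i => -partialAt N p i) (partialAt ψ p),
    surfaceDeriv_apply, surfaceDeriv_apply, ← inner_neg_left]
  congr 1
  simp; abel

/-- If `c > 0`, the point would also be a local minimum, so `g` would be locally constant and `c`
would vanish. -/
theorem nonpos_of_isLocalMax_of_hasDerivAt {g g' : ℝ → ℝ} {c t : ℝ}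
    (hg : ∀ᶠ s in 𝓝 t, HasDerivAt g (g' s) s) (hg' : HasDerivAt g' c t) (hmax : IsLocalMax g t) :
    c ≤ 0 := by
  by_contra! hc
  have h1 : deriv g =ᶠ[𝓝 t] g' := hg.mono fun s hs => hs.deriv
  have h2 : deriv (deriv g) t = c := by rw [h1.deriv_eq, hg'.deriv]
  have hmin := isLocalMin_of_deriv_deriv_pos (h2 ▸ hc) hmax.deriv_eq_zero
    hg.self_of_nhds.continuousAt
  have h3 : g =ᶠ[𝓝 t] fun _ => g t := by
    filter_upwards [hmax, hmin] with s h1 h2 using le_antisymm h1 h2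
  have h4 : deriv (deriv g) t = 0 := by
    rw [h3.deriv.deriv_eq]; simp
  linarith

theorem IsOrientedImmersedSurface.mem_range_surfaceDeriv {ψ N : M → E3}
    (hS : IsOrientedImmersedSurface ψ N) (p : M) {t : E3} (ht : inner ℝ (N p) t = 0) :
    ∃ e, surfaceDeriv ψ p e = t := by
  set D := surfaceDeriv ψ p
  have hle : LinearMap.range D.toLinearMap ≤ (ℝ ∙ N p)ᗮ := by
    rintro _ ⟨e, rfl⟩
    rw [Submodule.mem_orthogonal_singleton_iff_inner_right]
    exact inner_normal_surfaceDeriv hS p e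
  have hN : N p ≠ 0 := by
    rw [← norm_ne_zero_iff, hS.norm_normal]; exact one_ne_zero
  have : Fact (Module.finrank ℝ E3 = 2 + 1) := ⟨by simp⟩
  have heq : LinearMap.range D.toLinearMap = (ℝ ∙ N p)ᗮ := by
    apply Submodule.eq_of_le_of_finrank_eq hle
    rw [Submodule.finrank_orthogonal_span_singleton (n := 2) hN, LinearMap.finrank_range_of_inj]
    · simp
    · exact hS.injective_mfderiv p
  have : t ∈ LinearMap.range D.toLinearMap := by
    rw [heq, Submodule.mem_orthogonal_singleton_iff_inner_right]; exact ht
  exact this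

/-- Second derivative test for the restriction of a function on space to a translator. -/
theorem IsLambdaTranslator.exists_frame_of_isLocalMax [IsManifold (𝓡∂ 2) 2 M] {lam : ℝ} {w : E3}
    {ψ N : M → E3} (hM : IsLambdaTranslator lam w ψ N) {p : M} (hp : (𝓡∂ 2).IsInteriorPoint p)
    {F : E3 → ℝ} {G : E3 → E3} {A : E3 →L[ℝ] E3}
    (hF : ∀ x, HasFDerivAt F (innerSL ℝ (G x)) x) (hG : HasFDerivAt G A (ψ p))
    (hmax : IsLocalMax (F ∘ ψ) p) :
    ∃ b : OrthonormalBasis (Fin 3) ℝ E3, b 2 = N p ∧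
      inner ℝ (A (b 0)) (b 0) + inner ℝ (A (b 1)) (b 1) + 2 * inner ℝ (G (ψ p)) w +
        2 * lam * inner ℝ (G (ψ p)) (N p) ≤ 0 := by
  have hS := hM.toIsOrientedImmersedSurface
  set φ := extChartAt (𝓡∂ 2) p with hφ
  set x₀ := φ p with hx₀
  set Ψ := ψ ∘ φ.symm with hΨ
  set n := N ∘ φ.symm with hn
  set D := fderiv ℝ Ψ x₀ with hD
  have hsymm : φ.symm x₀ = p := extChartAt_to_inv p
  have hΨx₀ : Ψ x₀ = ψ p := by simp only [hΨ, Function.comp, hsymm]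
  have hnx₀ : n x₀ = N p := by simp only [hn, Function.comp, hsymm]
  have hψD : surfaceDeriv ψ p = D :=
    surfaceDeriv_eq_fderiv hp (hS.contMDiff.mdifferentiableAt (by norm_num))
  have hND : surfaceDeriv N p = fderiv ℝ n x₀ :=
    surfaceDeriv_eq_fderiv hp (hS.contMDiff_normal.mdifferentiableAt (by norm_num))
  have hΨ2 : ContDiffAt ℝ 2 Ψ x₀ := contDiffAt_comp_extChartAt_symm hp hS.contMDiff.contMDiffAt
  have hn1 : ContDiffAt ℝ 1 n x₀ :=
    contDiffAt_comp_extChartAt_symm hp hS.contMDiff_normal.contMDiffAt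
  have hΨd : ∀ᶠ x in 𝓝 x₀, DifferentiableAt ℝ Ψ x := by
    filter_upwards [(hΨ2.of_le (m := 1) (by norm_num)).eventually (by simp)] with x hx
      using hx.differentiableAt (by norm_num)
  have hDd : DifferentiableAt ℝ (fderiv ℝ Ψ) x₀ :=
    (hΨ2.fderiv_right (m := 1) (by norm_num)).differentiableAt (by norm_num)
  have horth := eventually_inner_normal_fderiv hS hp
  have hmax' : IsLocalMax (F ∘ Ψ) x₀ := by
    have hc : ContinuousAt φ.symm x₀ := continuousAt_extChartAt_symm p
    have h0 : ∀ᶠ q in 𝓝 (φ.symm x₀), (F ∘ ψ) q ≤ (F ∘ ψ) p := by rw [hsymm]; exact hmax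
    have := hc.eventually h0
    filter_upwards [this] with x hx
    simpa only [hΨ, Function.comp, hsymm] using hx
  -- first order condition
  have hfirst : ∀ e, inner ℝ (G (ψ p)) (D e) = 0 := by
    intro e
    have h1 : HasFDerivAt (F ∘ Ψ) ((innerSL ℝ (G (Ψ x₀))).comp D) x₀ :=
      (hF (Ψ x₀)).comp x₀ hΨd.self_of_nhds.hasFDerivAt
    have h2 := hmax'.hasFDerivAt_eq_zero h1
    have h3 := DFunLike.congr_fun h2 e
    rw [hΨx₀] at h3
    simpa using h3
  -- second order condition
  have hsecond : ∀ e, inner ℝ (A (D e)) (D e) +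
      inner ℝ (G (ψ p)) (fderiv ℝ (fderiv ℝ Ψ) x₀ e e) ≤ 0 := by
    intro e
    have hline : ∀ s : ℝ, HasDerivAt (fun s : ℝ => x₀ + s • e) e s := fun s => by
      simpa using ((hasDerivAt_id s).smul_const e).const_add x₀
    have ht : Tendsto (fun s : ℝ => x₀ + s • e) (𝓝 0) (𝓝 x₀) := by
      have := (hline 0).continuousAt.tendsto
      simpa using this
    refine nonpos_of_isLocalMax_of_hasDerivAt (g := fun s => F (Ψ (x₀ + s • e)))
      (g' := fun s => inner ℝ (G (Ψ (x₀ + s • e))) (fderiv ℝ Ψ (x₀ + s • e) e)) (t := 0) ?_ ?_ ?_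
    · filter_upwards [ht.eventually hΨd] with s hs
      have := (hF _).comp_hasDerivAt s (hs.hasFDerivAt.comp_hasDerivAt s (hline s))
      simpa [Function.comp_def] using this
    · have e1 : HasDerivAt (fun s : ℝ => G (Ψ (x₀ + s • e))) (A (D e)) 0 := by
        have a1 : HasFDerivAt Ψ D (x₀ + (0:ℝ) • e) := by
          simpa using hΨd.self_of_nhds.hasFDerivAt
        have a2 := a1.comp_hasDerivAt 0 (hline 0)
        have a3 : HasFDerivAt G A (Ψ (x₀ + (0:ℝ) • e)) := by
          simpa [hΨx₀] using hG
        exact a3.comp_hasDerivAt (0:ℝ) a2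
      have e2 : HasDerivAt (fun s : ℝ => fderiv ℝ Ψ (x₀ + s • e) e)
          (fderiv ℝ (fderiv ℝ Ψ) x₀ e e) 0 := by
        have a1 : HasFDerivAt (fderiv ℝ Ψ) (fderiv ℝ (fderiv ℝ Ψ) x₀) (x₀ + (0:ℝ) • e) := by
          simpa using hDd.hasFDerivAt
        have a2 := a1.comp_hasDerivAt 0 (hline 0)
        simpa using a2.clm_apply (hasDerivAt_const (0:ℝ) e)
      have := e1.inner ℝ e2
      simp only [zero_smul, add_zero, hΨx₀] at this
      rw [add_comm]
      exact this
    · have := ht.eventually hmax'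
      filter_upwards [this] with s hs
      simpa using hs
  -- the second derivative of the parametrization along the normal
  have hnormal : ∀ e, inner ℝ (N p) (fderiv ℝ (fderiv ℝ Ψ) x₀ e e) =
      -inner ℝ (fderiv ℝ n x₀ e) (D e) := by
    intro e
    have a1 : HasFDerivAt (fun x => fderiv ℝ Ψ x e)
        ((ContinuousLinearMap.apply ℝ E3 e).comp (fderiv ℝ (fderiv ℝ Ψ) x₀)) x₀ :=
      (ContinuousLinearMap.apply ℝ E3 e).hasFDerivAt.comp x₀ hDd.hasFDerivAt
    have a2 := (hn1.differentiableAt (by norm_num)).hasFDerivAt.inner ℝ a1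
    have a3 : (fun x => (inner ℝ (n x) (fderiv ℝ Ψ x e) : ℝ)) =ᶠ[𝓝 x₀] fun _ => 0 :=
      horth.mono fun x hx => hx e
    have a4 := a2.unique ((hasFDerivAt_const (0:ℝ) x₀).congr_of_eventuallyEq a3)
    have a5 := DFunLike.congr_fun a4 e
    simp [fderivInnerCLM_apply] at a5
    rw [hnx₀] at a5
    linarith
  obtain ⟨b, hb⟩ := Orthonormal.exists_orthonormalBasis_extension_of_card_eq (𝕜 := ℝ) (E := E3)
    (ι := Fin 3) (by simp) (v := fun _ => N p) (s := {2}) (by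
      rw [orthonormal_iff_ite]
      rintro ⟨i, hi⟩ ⟨j, hj⟩
      simp only [mem_singleton_iff] at hi hj
      subst hi; subst hj
      simp [hS.norm_normal])
  have hb2 : b 2 = N p := hb 2 rfl
  have hbo := orthonormal_iff_ite.1 b.orthonormal
  obtain ⟨e0, he0⟩ := hS.mem_range_surfaceDeriv p (t := b 0) (by rw [← hb2, hbo]; simp)
  obtain ⟨e1, he1⟩ := hS.mem_range_surfaceDeriv p (t := b 1) (by rw [← hb2, hbo]; simp)
  have hon : Orthonormal ℝ fun i : Fin 2 =>
      surfaceDeriv ψ p (![e0, e1] i) := by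
    rw [orthonormal_iff_ite]
    intro i j
    fin_cases i <;> fin_cases j <;> simp [he0, he1, hbo]
  have hH := meanCurvature_eq_of_orthonormal ψ N p ![e0, e1] hon
  rw [hM.meanCurvature_eq, hψD, hND] at hH
  rw [hψD] at he0 he1
  simp only [Fin.sum_univ_two, Matrix.cons_val_zero, Matrix.cons_val_one, he0, he1] at hH
  -- By the first order condition the gradient has no tangential part, so only the normal component
  -- of the second derivative of `Ψ` matters, and that is curvature.
  have hGN : G (ψ p) = (inner ℝ (G (ψ p)) (N p) : ℝ) • N p := by
    have := b.sum_repr' (G (ψ p))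
    rw [Fin.sum_univ_three] at this
    have z0 := hfirst e0
    have z1 := hfirst e1
    rw [he0, real_inner_comm] at z0
    rw [he1, real_inner_comm] at z1
    rw [z0, z1, hb2, real_inner_comm] at this
    simpa using this.symm
  refine ⟨b, hb2, ?_⟩
  have s0 := hsecond e0
  have s1 := hsecond e1
  have n0 := hnormal e0
  have n1 := hnormal e1
  rw [he0] at s0 n0
  rw [he1] at s1 n1
  set μ : ℝ := inner ℝ (G (ψ p)) (N p) with hμ
  rw [hGN, inner_smul_left, n0] at s0
  rw [hGN, inner_smul_left, n1] at s1
  rw [hGN, inner_smul_left]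
  simp only [conj_trivial] at s0 s1 ⊢
  have h2 : μ * (2 * (inner ℝ (N p) w + lam)) = μ * (-(inner ℝ ((fderiv ℝ n x₀) e0) (b 0) +
      inner ℝ ((fderiv ℝ n x₀) e1) (b 1))) := congrArg (μ * ·) hH
  linarith

end Surface

/-! ### Chords of an immersed surface -/

section Surface

variable {M : Type*} [TopologicalSpace M] [ChartedSpace (EuclideanHalfSpace 2) M]

/-- Near an interior point an immersed surface is embedded, and its chords are nearly tangent. -/
theorem IsOrientedImmersedSurface.exists_nhds_chord {ψ N : M → E3}
    (hS : IsOrientedImmersedSurface ψ N) {p : M} (hp : (𝓡∂ 2).IsInteriorPoint p) :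
    ∃ V ∈ 𝓝 p, ∀ q ∈ V, ∀ q' ∈ V, (ψ q = ψ q' → q = q') ∧
      |(inner ℝ (N q) (ψ q - ψ q') : ℝ)| ≤ 1 / 2 * ‖ψ q - ψ q'‖ := by
  set φ := extChartAt (𝓡∂ 2) p with hφ
  set x₀ := φ p with hx₀
  set Ψ := ψ ∘ φ.symm with hΨ
  set D := fderiv ℝ Ψ x₀ with hD
  have hψD : surfaceDeriv ψ p = D :=
    surfaceDeriv_eq_fderiv hp (hS.contMDiff.mdifferentiableAt (by norm_num))
  have hΨ2 : ContDiffAt ℝ 2 Ψ x₀ := contDiffAt_comp_extChartAt_symm hp hS.contMDiff.contMDiffAt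
  have hstrict : HasStrictFDerivAt Ψ D x₀ := hΨ2.hasStrictFDerivAt (by norm_num)
  have hDinj : Function.Injective D := by
    rw [← hψD]; exact hS.injective_mfderiv p
  obtain ⟨K, hK0, hK⟩ := D.toLinearMap.exists_antilipschitzWith (LinearMap.ker_eq_bot.2 hDinj)
  have hK' : ∀ z, ‖z‖ ≤ K * ‖D z‖ := fun z => by
    simpa using hK.le_mul_dist z 0
  have hK0' : (0 : ℝ) < K := hK0
  -- The bound `1 / (5 * K)` makes the linearization error at most a quarter of the chord; `1 / 4`
  -- does the same for the variation of `N`. Together they give the factor `1 / 2`.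
  set η : ℝ := min (1 / (5 * K)) (1 / 4) with hη
  have hη0 : 0 < η := by positivity
  have hη1 : η * (5 * K) ≤ 1 := by
    have : η ≤ 1 / (5 * K) := min_le_left _ _
    rwa [le_div_iff₀ (by positivity)] at this
  have hη2 : η ≤ 1 / 4 := min_le_right _ _
  have hlo := (hasStrictFDerivAt_iff_isLittleO.1 hstrict).def hη0
  obtain ⟨W, hW, hWW⟩ := (eventually_prod_self_iff (r := fun x y => ‖Ψ x - Ψ y - D (x - y)‖ ≤ η * ‖x - y‖)).1
    (by rw [← nhds_prod_eq]; exact hlo)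
  have hcont : ContinuousAt φ p := continuousAt_extChartAt p
  have hNc : ∀ᶠ q in 𝓝 p, ‖N q - N p‖ < η := by
    have := (hS.contMDiff_normal.continuous.continuousAt (x := p)).eventually
      (Metric.ball_mem_nhds (N p) hη0)
    filter_upwards [this] with q hq
    rwa [← dist_eq_norm]
  refine ⟨φ.source ∩ φ ⁻¹' W ∩ {q | ‖N q - N p‖ < η},
    inter_mem (inter_mem (extChartAt_source_mem_nhds p) (hcont.preimage_mem_nhds hW)) hNc, ?_⟩
  rintro q ⟨⟨hqs, hqW⟩, hqN⟩ q' ⟨⟨hqs', hqW'⟩, -⟩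
  have h1 := hWW (φ q) hqW (φ q') hqW'
  simp only [hΨ, Function.comp, φ.left_inv hqs, φ.left_inv hqs'] at h1
  set z := φ q - φ q' with hz
  set d := ψ q - ψ q' with hd
  have h2 : ‖z‖ ≤ K * (‖d‖ + η * ‖z‖) := by
    refine (hK' z).trans (mul_le_mul_of_nonneg_left ?_ hK0'.le)
    have : ‖D z‖ ≤ ‖d‖ + ‖d - D z‖ := by
      have := norm_sub_le d (d - D z)
      simpa using this
    linarith
  have h3 : 4 / 5 * ‖z‖ ≤ K * ‖d‖ := by
    nlinarith [norm_nonneg z]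
  have h4 : η * ‖z‖ ≤ 1 / 4 * ‖d‖ := by
    nlinarith [norm_nonneg z, norm_nonneg d]
  constructor
  · intro heq
    have hd0 : ‖d‖ = 0 := by rw [hd, heq]; simp
    rw [hd0] at h3
    have : ‖z‖ = 0 := le_antisymm (by linarith) (norm_nonneg _)
    exact φ.injOn hqs hqs' (sub_eq_zero.1 (norm_eq_zero.1 this))
  · have e1 : (inner ℝ (N q) d : ℝ) = inner ℝ (N p) (d - D z) + inner ℝ (N q - N p) d := by
      rw [inner_sub_right (N p), inner_sub_left (N q), ← hψD, inner_normal_surfaceDeriv hS]; ring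
    have e2 : |(inner ℝ (N p) (d - D z) : ℝ)| ≤ η * ‖z‖ := by
      refine (abs_real_inner_le_norm _ _).trans ?_
      rw [hS.norm_normal, one_mul]; exact h1
    have e3 : |(inner ℝ (N q - N p) d : ℝ)| ≤ 1 / 4 * ‖d‖ := by
      refine (abs_real_inner_le_norm _ _).trans ?_
      exact mul_le_mul_of_nonneg_right (le_of_lt (lt_of_lt_of_le hqN hη2)) (norm_nonneg _)
    rw [e1]
    refine (abs_add_le _ _).trans ?_
    linarith

end Surface

/-! ### The exponential barrier -/

/-- Where `h < 0` any `ε` works; where `h ≥ 0`, compactness leaves a uniform gap between `u` and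
`m`. This selects the size of the barrier. -/
theorem exists_pos_add_mul_lt_of_isCompact {X : Type*} [TopologicalSpace X] {S : Set X}
    (hS : IsCompact S) {u h : X → ℝ} (hu : ContinuousOn u S) (hh : ContinuousOn h S) {m : ℝ}
    (hle : ∀ x ∈ S, u x ≤ m) (hlt : ∀ x ∈ S, 0 ≤ h x → u x < m) :
    ∃ ε > 0, ∀ x ∈ S, u x + ε * h x < m := by
  obtain ⟨C, hC⟩ := hS.exists_bound_of_continuousOn hh
  have hScomp : IsCompact (S ∩ h ⁻¹' Ici 0) := by
    obtain ⟨t, ht, hteq⟩ := continuousOn_iff_isClosed.1 hh (Ici 0) isClosed_Ici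
    rw [inter_comm, hteq, inter_comm]
    exact hS.inter_right ht
  rcases (S ∩ h ⁻¹' Ici 0).eq_empty_or_nonempty with hE | hne
  · refine ⟨1, one_pos, fun x hx => ?_⟩
    have : h x < 0 := by
      by_contra! h0
      exact (hE ▸ (⟨hx, h0⟩ : x ∈ S ∩ h ⁻¹' Ici 0) : x ∈ (∅ : Set X))
    linarith [hle x hx]
  · obtain ⟨x₁, hx₁, hmax⟩ := hScomp.exists_isMaxOn hne (hu.mono inter_subset_left)
    have hm : u x₁ < m := hlt x₁ hx₁.1 hx₁.2
    have hC0 : 0 ≤ C := (norm_nonneg _).trans (hC x₁ hx₁.1)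
    have hε : 0 < (m - u x₁) / (C + 1) := div_pos (by linarith) (by linarith)
    refine ⟨_, hε, fun x hx => ?_⟩
    rcases lt_or_ge (h x) 0 with h0 | h0
    · have := mul_neg_of_pos_of_neg hε h0
      linarith [hle x hx]
    · have h1 : u x ≤ u x₁ := hmax (⟨hx, h0⟩ : x ∈ S ∩ h ⁻¹' Ici 0)
      have h2 : h x < C + 1 := by
        have := (le_abs_self _).trans (hC x hx); linarith
      have h3 : (m - u x₁) / (C + 1) * h x < (m - u x₁) / (C + 1) * (C + 1) :=
        mul_lt_mul_of_pos_left h2 hε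
      rw [div_mul_cancel₀ _ (by linarith)] at h3
      linarith

/-- The gradient of `x ↦ ⟪x, v⟫ + ε exp (-α ‖x - y‖²)`. -/
theorem hasFDerivAt_inner_add_exp (v y : E3) (ε α : ℝ) (x : E3) :
    HasFDerivAt (fun x : E3 => inner ℝ x v + ε * Real.exp (-α * ‖x - y‖ ^ 2))
      (innerSL ℝ (v + (-(2 * ε * α) * Real.exp (-α * ‖x - y‖ ^ 2)) • (x - y))) x := by
  have h1 : HasFDerivAt (fun x : E3 => ‖x - y‖ ^ 2) (2 • (innerSL ℝ (x - y))) x := by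
    simpa using ((hasFDerivAt_id x).sub_const y).norm_sq
  have h2 := ((h1.const_mul (-α)).exp).const_mul ε
  have h3 : HasFDerivAt (fun x : E3 => (inner ℝ x v : ℝ)) (innerSL ℝ v) x := by
    simpa [real_inner_comm] using! (innerSL ℝ v).hasFDerivAt (x := x)
  refine (h3.add h2).congr_fderiv ?_
  ext z
  simp
  ring

/-- The Hessian of `x ↦ ⟪x, v⟫ + ε exp (-α ‖x - y‖²)`. -/
theorem hasFDerivAt_gradient_inner_add_exp (v y : E3) (ε α : ℝ) (x : E3) :
    ∃ A : E3 →L[ℝ] E3,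
      HasFDerivAt
        (fun x : E3 => v + (-(2 * ε * α) * Real.exp (-α * ‖x - y‖ ^ 2)) • (x - y)) A x ∧
      ∀ t, (inner ℝ (A t) t : ℝ) = ε * Real.exp (-α * ‖x - y‖ ^ 2) *
        (4 * α ^ 2 * (inner ℝ t (x - y)) ^ 2 - 2 * α * ‖t‖ ^ 2) := by
  have h1 : HasFDerivAt (fun x : E3 => ‖x - y‖ ^ 2) (2 • (innerSL ℝ (x - y))) x := by
    simpa using ((hasFDerivAt_id x).sub_const y).norm_sq
  have h2 := ((h1.const_mul (-α)).exp).const_mul (-(2 * ε * α))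
  have h3 := (h2.smul ((hasFDerivAt_id x).sub_const y)).const_add v
  refine ⟨_, h3, fun t => ?_⟩
  simp [inner_add_left, inner_smul_left]
  rw [← inner_sub_left, real_inner_comm t (x - y)]
  ring

/-! ### The strong maximum principle -/

section Surface

variable {M : Type*} [TopologicalSpace M] [ChartedSpace (EuclideanHalfSpace 2) M]
  [IsManifold (𝓡∂ 2) 2 M]

/-- The bounds on `ψ q - y` leave a squared tangential part of at least `(4/25 - 9/100) R² = 7/100
R²`. The Hessian term quadratic in `α` then beats the remaining barrier terms, which are bounded
through `1 + 3/5 R + 3/5 R`; this dictates the choice of `α`. -/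
theorem IsLambdaTranslator.not_isLocalMax_inner_add_exp {lam : ℝ} {v w : E3} {ψ N : M → E3}
    (hM : IsLambdaTranslator lam w ψ N) (hlam : 0 ≤ lam) (hv : ‖v‖ = 1) (hw : ‖w‖ = 1)
    (hvw : lam ≤ inner ℝ v w) {q : M} (hq : (𝓡∂ 2).IsInteriorPoint q) {y : E3} {R ε α : ℝ}
    (hR : 0 < R) (hε : 0 < ε) (hα : α * (7 / 100 * R ^ 2) = 2 + 6 / 5 * R)
    (hlo : 2 / 5 * R ≤ ‖ψ q - y‖) (hhi : ‖ψ q - y‖ ≤ 3 / 5 * R)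
    (hN : |(inner ℝ (N q) (ψ q - y) : ℝ)| ≤ 3 / 10 * R) :
    ¬ IsLocalMax ((fun x : E3 => inner ℝ x v + ε * Real.exp (-α * ‖x - y‖ ^ 2)) ∘ ψ) q := by
  intro hmax
  obtain ⟨A, hA, hAt⟩ := hasFDerivAt_gradient_inner_add_exp v y ε α (ψ q)
  obtain ⟨b, hb2, hb⟩ := hM.exists_frame_of_isLocalMax hq
    (hasFDerivAt_inner_add_exp v y ε α) hA hmax
  have hα0 : 0 < α := by
    by_contra! h
    nlinarith [mul_nonneg (neg_nonneg.2 h) (by positivity : 0 ≤ 7 / 100 * R ^ 2)]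
  have hsum := b.sum_sq_norm_inner_right (ψ q - y)
  rw [Fin.sum_univ_three, hb2] at hsum
  simp only [Real.norm_eq_abs, sq_abs] at hsum
  have hn0 : ‖b 0‖ = 1 := b.norm_eq_one 0
  have hn1 : ‖b 1‖ = 1 := b.norm_eq_one 1
  rw [hAt, hAt, hn0, hn1, inner_add_left, inner_add_left, inner_smul_left, inner_smul_left] at hb
  simp only [conj_trivial] at hb
  set z := ψ q - y with hz
  set X := ε * Real.exp (-α * ‖z‖ ^ 2) with hX
  have hX0 : 0 < X := mul_pos hε (Real.exp_pos _)
  have hNsq : (inner ℝ (N q) z : ℝ) ^ 2 ≤ (3 / 10 * R) ^ 2 := sq_le_sq' (abs_le.1 hN).1 (abs_le.1 hN).2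
  have hzsq : (2 / 5 * R) ^ 2 ≤ ‖z‖ ^ 2 := pow_le_pow_left₀ (by positivity) hlo 2
  have hT : 7 / 100 * R ^ 2 ≤ (inner ℝ (b 0) z : ℝ) ^ 2 + (inner ℝ (b 1) z : ℝ) ^ 2 := by
    nlinarith
  have hzw : (inner ℝ z w : ℝ) ≤ 3 / 5 * R := by
    have := real_inner_le_norm z w
    rw [hw, mul_one] at this
    linarith
  have hlam1 : lam ≤ 1 := by
    have := real_inner_le_norm v w
    rw [hv, hw] at this
    linarith
  have hzN : lam * (inner ℝ z (N q) : ℝ) ≤ 3 / 5 * R := by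
    rw [real_inner_comm]
    have h1 := (abs_le.1 hN).2
    nlinarith
  have hvN : -1 ≤ (inner ℝ v (N q) : ℝ) := by
    have := (abs_le.1 (abs_real_inner_le_norm v (N q))).1
    rw [hv, hM.norm_normal] at this
    linarith
  -- The contribution of the height itself has the right sign exactly because `⟪v, w⟫ ≥ lam`.
  have hc : 0 ≤ (inner ℝ v w : ℝ) + lam * inner ℝ v (N q) := by nlinarith
  set T : ℝ := (inner ℝ (b 0) z : ℝ) ^ 2 + (inner ℝ (b 1) z : ℝ) ^ 2 with hTdef
  have key : X * (4 * α) * (α * T - 1 - inner ℝ z w - lam * inner ℝ z (N q)) ≤ 0 := by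
    refine le_trans (le_of_eq ?_) (le_trans (sub_le_sub_right hb
      (2 * ((inner ℝ v w : ℝ) + lam * inner ℝ v (N q)))) (by linarith))
    rw [hTdef, hX]
    ring
  have hpos : 0 < α * T - 1 - inner ℝ z w - lam * inner ℝ z (N q) := by
    have := mul_le_mul_of_nonneg_left hT hα0.le
    linarith
  exact absurd key (not_le.2 (by positivity))

/-- Local strong maximum principle for the height of a translator. -/
theorem IsLambdaTranslator.eventually_height_eq [T2Space M] [CompactSpace M] {lam : ℝ} {v w : E3}
    {ψ N : M → E3} (hM : IsLambdaTranslator lam w ψ N) (hlam : 0 ≤ lam) (hv : ‖v‖ = 1)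
    (hw : ‖w‖ = 1) (hvw : lam ≤ inner ℝ v w) {p : M} (hp : (𝓡∂ 2).IsInteriorPoint p) {m : ℝ}
    (hpm : inner ℝ (ψ p) v = m) (hle : ∀ q, inner ℝ (ψ q) v ≤ m) :
    ∀ᶠ q in 𝓝 p, inner ℝ (ψ q) v = m := by
  have hS := hM.toIsOrientedImmersedSurface
  have hψc : Continuous ψ := hS.contMDiff.continuous
  have hfc : Continuous fun q => (inner ℝ (ψ q) v : ℝ) := hψc.inner continuous_const
  obtain ⟨V, hV, hchord⟩ := hS.exists_nhds_chord hp
  have hint : (𝓡∂ 2).interior M ∈ 𝓝 p :=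
    (ModelWithCorners.isOpen_interior (n := 2) (by norm_num)).mem_nhds hp
  obtain ⟨C, hC, hCV, hCc⟩ := local_compact_nhds (inter_mem hV hint)
  have hpC : p ∈ C := mem_of_mem_nhds hC
  have hpV : p ∈ V := mem_of_mem_nhds hV
  -- Injectivity of `ψ` near `p` keeps the image of the frontier of `C` away from `ψ p`, so
  -- distances in space can localize points of the surface.
  obtain ⟨r, hr0, hr⟩ : ∃ r > 0, ∀ q ∈ C, ‖ψ q - ψ p‖ < r → q ∈ interior C := by
    have hcomp : IsCompact (C \ interior C) := hCc.diff isOpen_interior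
    rcases (C \ interior C).eq_empty_or_nonempty with hE | hne
    · exact ⟨1, one_pos, fun q hq _ => by
        by_contra h; exact (hE ▸ (⟨hq, h⟩ : q ∈ C \ interior C) : q ∈ (∅ : Set M))⟩
    · obtain ⟨q₀, hq₀, hmin⟩ := hcomp.exists_isMinOn hne
        (f := fun q => ‖ψ q - ψ p‖) (by fun_prop)
      refine ⟨‖ψ q₀ - ψ p‖, ?_, fun q hq hlt => ?_⟩
      · rw [gt_iff_lt, norm_pos_iff, sub_ne_zero]
        intro heq
        have := (hchord q₀ (hCV hq₀.1).1 p hpV).1 heq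
        subst this
        exact hq₀.2 (mem_interior_iff_mem_nhds.2 hC)
      · by_contra h
        exact absurd (hmin (⟨hq, h⟩ : q ∈ C \ interior C)) (not_le.2 hlt)
  have hnear : ∀ᶠ q in 𝓝 p, ‖ψ q - ψ p‖ < r / 4 := by
    have : ContinuousAt (fun q => ‖ψ q - ψ p‖) p := by fun_prop
    exact this.eventually_lt continuousAt_const (by simpa using by positivity)
  filter_upwards [hC, hnear] with y hyC hyr
  by_contra hne
  have hym : (inner ℝ (ψ y) v : ℝ) < m := lt_of_le_of_ne (hle y) hne
  -- the nearest point of the level set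
  have hKc : IsCompact (C ∩ {q | (inner ℝ (ψ q) v : ℝ) = m}) :=
    hCc.inter_right (isClosed_eq hfc continuous_const)
  obtain ⟨q₁, ⟨hq₁C, hq₁m⟩, hmin⟩ := hKc.exists_isMinOn ⟨p, hpC, hpm⟩
    (f := fun q => ‖ψ q - ψ y‖) (by fun_prop)
  simp only [mem_ofPred_eq] at hq₁m
  set R := ‖ψ q₁ - ψ y‖ with hRdef
  have hR0 : 0 < R := by
    rw [hRdef, norm_pos_iff, sub_ne_zero]
    intro heq
    rw [heq] at hq₁m
    exact hne hq₁m
  have hRr : R < r / 4 := by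
    have h1 : R ≤ ‖ψ p - ψ y‖ := hmin (⟨hpC, hpm⟩ : p ∈ C ∩ {q | (inner ℝ (ψ q) v : ℝ) = m})
    rw [norm_sub_rev] at h1
    linarith
  -- The ball of radius `R / 2` about this midpoint is internally tangent at `ψ q₁` to the ball of
  -- radius `R` about `ψ y`, so its closure meets the image of the level set in `C` only at `ψ q₁`.
  set c : E3 := (1 / 2 : ℝ) • (ψ q₁ + ψ y) with hc
  set α : ℝ := (2 + 6 / 5 * R) / (7 / 100 * R ^ 2) with hα
  have hα' : α * (7 / 100 * R ^ 2) = 2 + 6 / 5 * R := div_mul_cancel₀ _ (by positivity)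
  have hα0 : 0 < α := by positivity
  have hq₁c : ‖ψ q₁ - c‖ = R / 2 := by
    have : ψ q₁ - c = (1 / 2 : ℝ) • (ψ q₁ - ψ y) := by rw [hc]; module
    rw [this, norm_smul, ← hRdef]; norm_num; ring
  set D := C ∩ {q | ‖ψ q - ψ q₁‖ ≤ R / 10} with hD
  have hDc : IsCompact D := hCc.inter_right (isClosed_le (by fun_prop) continuous_const)
  set S := C ∩ {q | ‖ψ q - ψ q₁‖ = R / 10} with hSdef
  have hSc : IsCompact S := hCc.inter_right (isClosed_eq (by fun_prop) continuous_const)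
  obtain ⟨ε, hε, hεS⟩ := exists_pos_add_mul_lt_of_isCompact hSc
    (u := fun q => inner ℝ (ψ q) v)
    (h := fun q => Real.exp (-α * ‖ψ q - c‖ ^ 2) - Real.exp (-α * (R / 2) ^ 2)) (m := m)
    hfc.continuousOn (by fun_prop) (fun q _ => hle q) (by
      rintro q ⟨hqC, hqS⟩ hq
      refine lt_of_le_of_ne (hle q) fun hqm => ?_
      have h1 : R ≤ ‖ψ q - ψ y‖ := hmin (⟨hqC, hqm⟩ : q ∈ C ∩ {q | (inner ℝ (ψ q) v : ℝ) = m})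
      have h2 : ‖ψ q - c‖ ^ 2 ≤ (R / 2) ^ 2 := by
        have := Real.exp_le_exp.1 (sub_nonneg.1 hq)
        nlinarith
      -- It yields `4 ‖ψ q - c‖² ≥ R² + R² / 50`, contradicting `h2`.
      have h3 := parallelogram_law_with_norm ℝ (ψ q - ψ q₁) (ψ q - ψ y)
      have h4 : ψ q - ψ q₁ + (ψ q - ψ y) = (2 : ℝ) • (ψ q - c) := by rw [hc]; module
      have h5 : ‖ψ q - ψ q₁ - (ψ q - ψ y)‖ = R := by
        rw [hRdef, ← norm_neg]; congr 1; abel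
      simp only [mem_ofPred_eq] at hqS
      rw [h4, h5, norm_smul, hqS] at h3
      norm_num at h3
      nlinarith)
  have hq₁D : q₁ ∈ D := ⟨hq₁C, by simp; positivity⟩
  obtain ⟨q₂, ⟨hq₂C, hq₂D⟩, hmax⟩ := hDc.exists_isMaxOn ⟨q₁, hq₁D⟩
    (f := fun q => (inner ℝ (ψ q) v : ℝ) + ε * Real.exp (-α * ‖ψ q - c‖ ^ 2)) (by fun_prop)
  have hq₂lt : ‖ψ q₂ - ψ q₁‖ < R / 10 := by
    refine lt_of_le_of_ne hq₂D fun heq => ?_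
    have h1 := hεS q₂ ⟨hq₂C, heq⟩
    have h2 := hmax hq₁D
    simp only [mem_ofPred_eq, hq₁m, hq₁c] at h2
    linarith
  have hq₂int : q₂ ∈ interior C := by
    refine hr q₂ hq₂C ?_
    have : ψ q₂ - ψ p = (ψ q₂ - ψ q₁) + (ψ q₁ - ψ y) + (ψ y - ψ p) := by abel
    rw [this]
    have := norm_add₃_le (a := ψ q₂ - ψ q₁) (b := ψ q₁ - ψ y) (c := ψ y - ψ p)
    linarith
  have hz1 : ψ q₂ - c = (1 / 2 : ℝ) • (ψ q₂ - ψ q₁) + (1 / 2 : ℝ) • (ψ q₂ - ψ y) := by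
    rw [hc]; module
  have hz2 : ‖ψ q₂ - c - (ψ q₁ - c)‖ < R / 10 := by
    rwa [sub_sub_sub_cancel_right]
  have hz3 := abs_le.1 (abs_norm_sub_norm_le (ψ q₂ - c) (ψ q₁ - c))
  rw [hq₁c] at hz3
  have hy₂ : ‖ψ q₂ - ψ y‖ ≤ 11 / 10 * R := by
    have : ψ q₂ - ψ y = (ψ q₂ - ψ q₁) + (ψ q₁ - ψ y) := by abel
    rw [this]
    have := norm_add_le (ψ q₂ - ψ q₁) (ψ q₁ - ψ y)
    linarith
  refine hM.not_isLocalMax_inner_add_exp hlam hv hw hvw (hCV hq₂C).2 hR0 hε hα' (y := c)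
    (by linarith) (by linarith) ?_ ?_
  -- The two chord estimates give `1/4 (1/10 + 11/10) R = 3/10 R`.
  · rw [hz1, inner_add_right, inner_smul_right, inner_smul_right]
    have e1 := (hchord q₂ (hCV hq₂C).1 q₁ (hCV hq₁C).1).2
    have e2 := (hchord q₂ (hCV hq₂C).1 y (hCV hyC).1).2
    rw [abs_le] at e1 e2 ⊢
    constructor <;> linarith [e1.1, e1.2, e2.1, e2.2]
  · have hlt : ∀ᶠ q in 𝓝 q₂, ‖ψ q - ψ q₁‖ < R / 10 := by
      have : ContinuousAt (fun q => ‖ψ q - ψ q₁‖) q₂ := by fun_prop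
      exact this.eventually_lt continuousAt_const hq₂lt
    filter_upwards [mem_interior_iff_mem_nhds.1 hq₂int, hlt] with q hqC hq
    exact hmax (⟨hqC, hq.le⟩ : q ∈ D)

end Surface

/-! ### Propagation up to the boundary, flat surfaces and contact -/

section Surface

variable {M : Type*} [TopologicalSpace M] [ChartedSpace (EuclideanHalfSpace 2) M]

/-- Every point of a surface with boundary has a neighbourhood whose interior points contain
a dense connected set. -/
theorem exists_nhds_preconnected_interior [IsManifold (𝓡∂ 2) 2 M] (q : M) :
    ∃ U ∈ 𝓝 q, ∃ O ⊆ (𝓡∂ 2).interior M, IsPreconnected O ∧ U ⊆ closure O := by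
  set φ := extChartAt (𝓡∂ 2) q with hφ
  obtain ⟨r, hr, hball⟩ := Metric.mem_nhdsWithin_iff.1
    (extChartAt_target_mem_nhdsWithin (I := 𝓡∂ 2) q)
  set B := Metric.ball (φ q) r with hB
  have hOt : B ∩ interior (range (𝓡∂ 2)) ⊆ φ.target :=
    (inter_subset_inter_right _ interior_subset).trans hball
  have hcont : ContinuousOn φ.symm φ.target := continuousOn_extChartAt_symm q
  refine ⟨φ.source ∩ φ ⁻¹' B, inter_mem (extChartAt_source_mem_nhds q)
    ((continuousAt_extChartAt q).preimage_mem_nhds (Metric.ball_mem_nhds _ hr)),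
    φ.symm '' (B ∩ interior (range (𝓡∂ 2))), ?_, ?_, ?_⟩
  · rintro _ ⟨x, hx, rfl⟩
    have hxt := hOt hx
    have hsrc : φ.symm x ∈ (chartAt (EuclideanHalfSpace 2) q).source := by
      rw [← extChartAt_source (𝓡∂ 2)]; exact φ.map_target hxt
    refine (ModelWithCorners.isInteriorPoint_iff_of_mem_atlas (n := 2) (by norm_num)
      (chart_mem_atlas _ q) hsrc).2 ?_
    change φ (φ.symm x) ∈ interior φ.target
    rw [φ.right_inv hxt]
    exact interior_maximal hOt (Metric.isOpen_ball.inter isOpen_interior) hx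
  · exact (((convex_ball _ _).inter (𝓡∂ 2).convex_range.interior).isPreconnected).image _
      (hcont.mono hOt)
  · rintro y ⟨hys, hyB⟩
    rw [← φ.left_inv hys]
    have hyt := φ.map_source hys
    refine ((hcont _ hyt).mono hOt).mem_closure_image ?_
    refine Metric.isOpen_ball.inter_closure ⟨hyB, ?_⟩
    exact (𝓡∂ 2).range_subset_closure_interior (extChartAt_target_subset_range q hyt)

/-- A closed subset `Z` of a connected surface which meets the manifold interior, and which is a
neighbourhood of each point of the manifold interior lying in `Z`, is the whole surface. -/
theorem eq_univ_of_isClosed_of_forall_interior_mem_nhds [IsManifold (𝓡∂ 2) 2 M]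
    [PreconnectedSpace M] {Z : Set M} (hZ : IsClosed Z)
    (hnhds : ∀ p ∈ Z, (𝓡∂ 2).IsInteriorPoint p → Z ∈ 𝓝 p)
    (hne : ∃ p ∈ Z, (𝓡∂ 2).IsInteriorPoint p) : Z = univ := by
  have hclosure : closure (interior Z) ⊆ Z := closure_minimal interior_subset hZ
  -- At a boundary point, `interior Z` spreads over the connected set `O` of interior points, and
  -- density of `O` recovers a full neighbourhood.
  have hopen : IsOpen (closure (interior Z)) := by
    rw [isOpen_iff_mem_nhds]
    intro q hq
    obtain ⟨U, hU, O, hOint, hO, hUO⟩ := exists_nhds_preconnected_interior q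
    obtain ⟨a, haU, haZ⟩ := mem_closure_iff_nhds.1 hq U hU
    have hmeet : (O ∩ interior Z).Nonempty := by
      rw [inter_comm]
      exact mem_closure_iff.1 (hUO haU) _ isOpen_interior haZ
    have hsub : O ⊆ interior Z := by
      refine hO.subset_of_closure_inter_subset isOpen_interior hmeet ?_
      rintro p ⟨hp, hpO⟩
      exact mem_interior_iff_mem_nhds.2 (hnhds p (hclosure hp) (hOint hpO))
    exact mem_of_superset hU (hUO.trans (closure_mono hsub))
  obtain ⟨p, hpZ, hp⟩ := hne
  have huniv : closure (interior Z) = univ := IsClopen.eq_univ ⟨isClosed_closure, hopen⟩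
    ⟨p, subset_closure (mem_interior_iff_mem_nhds.2 (hnhds p hpZ hp))⟩
  exact univ_subset_iff.1 (huniv ▸ hclosure)

theorem IsOrientedImmersedSurface.eq_smul_normal_of_isLocalExtr {ψ N : M → E3}
    (hS : IsOrientedImmersedSurface ψ N) {p : M} (hp : (𝓡∂ 2).IsInteriorPoint p) {u : E3}
    (hext : IsLocalExtr (fun q => (inner ℝ (ψ q) u : ℝ)) p) :
    ∃ μ : ℝ, u = μ • N p := by
  set φ := extChartAt (𝓡∂ 2) p with hφ
  have hsymm : φ.symm (φ p) = p := extChartAt_to_inv p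
  have hψd : MDifferentiableAt (𝓡∂ 2) 𝓘(ℝ, E3) ψ p := hS.contMDiff.mdifferentiableAt (by norm_num)
  have hd : HasFDerivAt (ψ ∘ φ.symm) (surfaceDeriv ψ p) (φ p) := by
    rw [surfaceDeriv_eq_fderiv hp hψd]
    exact ((contDiffAt_comp_extChartAt_symm hp hS.contMDiff.contMDiffAt).differentiableAt
      (by norm_num)).hasFDerivAt
  have hext' : IsLocalExtr ((fun q => (inner ℝ (ψ q) u : ℝ)) ∘ φ.symm) (φ p) := by
    have hc : Tendsto φ.symm (𝓝 (φ p)) (𝓝 p) := by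
      have h : ContinuousAt φ.symm (φ p) := continuousAt_extChartAt_symm p
      rwa [ContinuousAt, hsymm] at h
    have h : IsExtrFilter (fun q => (inner ℝ (ψ q) u : ℝ)) (𝓝 p) (φ.symm (φ p)) := by
      rw [hsymm]; exact hext
    exact h.comp_tendsto hc
  have hzero : ∀ e, (inner ℝ (surfaceDeriv ψ p e) u : ℝ) = 0 := by
    intro e
    have h1 := hext'.hasFDerivAt_eq_zero (hd.inner ℝ (hasFDerivAt_const u (φ p)))
    simpa using DFunLike.congr_fun h1 e
  refine ⟨inner ℝ u (N p), ?_⟩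
  obtain ⟨e, he⟩ := hS.mem_range_surfaceDeriv p (t := u - (inner ℝ u (N p) : ℝ) • N p) (by
    rw [inner_sub_right, inner_smul_right, real_inner_self_eq_norm_sq, hS.norm_normal,
      real_inner_comm]
    ring)
  have h1 := hzero e
  have h2 := inner_normal_surfaceDeriv hS p e
  rw [he] at h1 h2
  refine sub_eq_zero.1 (inner_self_eq_zero (𝕜 := ℝ).1 ?_)
  rw [inner_sub_right (u - _), inner_smul_right, real_inner_comm (N p) (u - _), h2, h1, mul_zero,
    sub_zero]

theorem exists_ne_zero_inner_eq_zero {v : E3} (hv : v ≠ 0) : ∃ u : E3, u ≠ 0 ∧ (inner ℝ u v : ℝ) = 0 := by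
  have hlt : Module.finrank ℝ (Submodule.span ℝ {v}) < Module.finrank ℝ E3 :=
    (finrank_span_singleton hv).trans_lt (by simp)
  have hbot : (Submodule.span ℝ {v})ᗮ ≠ ⊥ := by
    intro h
    rw [Submodule.orthogonal_eq_bot_iff] at h
    rw [h, finrank_top] at hlt
    exact lt_irrefl _ hlt
  obtain ⟨u, hu, hu0⟩ := Submodule.exists_mem_ne_zero_of_ne_bot hbot
  refine ⟨u, hu0, ?_⟩
  rw [real_inner_comm]
  exact Submodule.mem_orthogonal_singleton_iff_inner_right.1 hu

/-- Maximize a linear function in a direction `u` orthogonal to `v`. At an interior maximum both `u`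
and `v` would be normal to the surface, which is impossible; so the maximum lies on the boundary,
where the height is zero. -/
theorem IsOrientedImmersedSurface.height_eq_zero_of_const [CompactSpace M] [Nonempty M]
    {ψ N : M → E3} (hS : IsOrientedImmersedSurface ψ N) {v : E3} (hv : v ≠ 0)
    (hbdry : ψ '' (𝓡∂ 2).boundary M ⊆ planeOrtho v) {m : ℝ}
    (hconst : ∀ q, inner ℝ (ψ q) v = m) : m = 0 := by
  obtain ⟨u, hu0, huv⟩ := exists_ne_zero_inner_eq_zero hv
  obtain ⟨p, -, hpmax⟩ := isCompact_univ.exists_isMaxOn univ_nonempty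
    (f := fun q => (inner ℝ (ψ q) u : ℝ))
    (hS.contMDiff.continuous.inner continuous_const).continuousOn
  rcases (𝓡∂ 2).isInteriorPoint_or_isBoundaryPoint p with hp | hp
  · obtain ⟨μ, hμ⟩ := hS.eq_smul_normal_of_isLocalExtr hp (u := u)
      (Or.inr (Eventually.of_forall fun q => hpmax (mem_univ q)))
    obtain ⟨κ, hκ⟩ := hS.eq_smul_normal_of_isLocalExtr hp (u := v)
      (Or.inr (Eventually.of_forall fun q => by simp only [hconst, le_refl]))
    rw [hμ, hκ, inner_smul_left, inner_smul_right, real_inner_self_eq_norm_sq,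
      hS.norm_normal] at huv
    simp only [conj_trivial, one_pow, mul_one, mul_eq_zero] at huv
    rcases huv with h | h
    · exact absurd (by rw [hμ, h, zero_smul]) hu0
    · exact absurd (by rw [hκ, h, zero_smul]) hv
  · rw [← hconst p]
    exact hbdry ⟨p, hp, rfl⟩

/-- An interior extremum of the height makes `v` parallel to the normal of the containing plane, so
the height is constant. Without one, maximum and minimum are both taken on the boundary. No
curvature is involved. -/
theorem IsOrientedImmersedSurface.height_eq_zero_of_isPlanar [CompactSpace M] [Nonempty M]
    {ψ N : M → E3} (hS : IsOrientedImmersedSurface ψ N) {v : E3} (hv : v ≠ 0)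
    (hbdry : ψ '' (𝓡∂ 2).boundary M ⊆ planeOrtho v) (hP : IsPlanar (range ψ)) (q : M) :
    (inner ℝ (ψ q) v : ℝ) = 0 := by
  obtain ⟨P, hP2, hPsub⟩ := hP
  obtain ⟨n, hn0, hn⟩ : ∃ n : E3, n ≠ 0 ∧ ∀ d ∈ P.direction, (inner ℝ d n : ℝ) = 0 := by
    have hbot : P.directionᗮ ≠ ⊥ := by
      intro h
      rw [Submodule.orthogonal_eq_bot_iff] at h
      rw [h, finrank_top] at hP2
      simp at hP2
    obtain ⟨n, hn, hn0⟩ := Submodule.exists_mem_ne_zero_of_ne_bot hbot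
    exact ⟨n, hn0, fun d hd => hn d hd⟩
  have hnconst : ∀ q q', (inner ℝ (ψ q) n : ℝ) = inner ℝ (ψ q') n := fun q q' => by
    rw [← sub_eq_zero, ← inner_sub_left]
    exact hn _ (AffineSubspace.vsub_mem_direction (hPsub ⟨q, rfl⟩) (hPsub ⟨q', rfl⟩))
  have hfc : ContinuousOn (fun q => (inner ℝ (ψ q) v : ℝ)) univ :=
    (hS.contMDiff.continuous.inner continuous_const).continuousOn
  by_cases hex : ∃ p, (𝓡∂ 2).IsInteriorPoint p ∧ IsLocalExtr (fun q => (inner ℝ (ψ q) v : ℝ)) p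
  · obtain ⟨p, hp, hext⟩ := hex
    obtain ⟨μ, hμ⟩ := hS.eq_smul_normal_of_isLocalExtr hp (u := n)
      (Or.inr (Eventually.of_forall fun q => (hnconst q p).le))
    obtain ⟨κ, hκ⟩ := hS.eq_smul_normal_of_isLocalExtr hp hext
    have hμ0 : μ ≠ 0 := by
      rintro rfl
      exact hn0 (by rw [hμ, zero_smul])
    have hvn : v = (κ * μ⁻¹) • n := by
      rw [hμ, smul_smul, mul_assoc, inv_mul_cancel₀ hμ0, mul_one, ← hκ]
    have hconst : ∀ q', (inner ℝ (ψ q') v : ℝ) = inner ℝ (ψ q) v := fun q' => by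
      rw [hvn, inner_smul_right, inner_smul_right, hnconst q' q]
    exact hS.height_eq_zero_of_const hv hbdry hconst
  · push Not at hex
    have hz : ∀ p, IsLocalExtr (fun q => (inner ℝ (ψ q) v : ℝ)) p → (inner ℝ (ψ p) v : ℝ) = 0 := by
      intro p hp
      rcases (𝓡∂ 2).isInteriorPoint_or_isBoundaryPoint p with h | h
      · exact absurd hp (hex p h)
      · exact hbdry ⟨p, h, rfl⟩
    obtain ⟨a, -, ha⟩ := isCompact_univ.exists_isMaxOn univ_nonempty hfc
    obtain ⟨b, -, hb⟩ := isCompact_univ.exists_isMinOn univ_nonempty hfc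
    have h1 := hz a (Or.inr (Eventually.of_forall fun q => ha (mem_univ q)))
    have h2 := hz b (Or.inl (Eventually.of_forall fun q => hb (mem_univ q)))
    have h3 : (inner ℝ (ψ q) v : ℝ) ≤ inner ℝ (ψ a) v := ha (mem_univ q)
    have h4 : (inner ℝ (ψ b) v : ℝ) ≤ inner ℝ (ψ q) v := hb (mem_univ q)
    linarith

theorem isPlanar_of_forall_inner_eq_zero {S : Set E3} {v : E3} (hv : v ≠ 0)
    (h : ∀ x ∈ S, (inner ℝ x v : ℝ) = 0) : IsPlanar S := by
  have : Fact (Module.finrank ℝ E3 = 2 + 1) := ⟨by simp⟩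
  refine ⟨(Submodule.span ℝ {v})ᗮ.toAffineSubspace, ?_, fun x hx => ?_⟩
  · rw [Submodule.toAffineSubspace_direction]
    exact Submodule.finrank_orthogonal_span_singleton hv
  · rw [SetLike.mem_coe, Submodule.mem_toAffineSubspace,
      Submodule.mem_orthogonal_singleton_iff_inner_left]
    exact h x hx

theorem interior_nonempty [IsManifold (𝓡∂ 2) 2 M] [Nonempty M] :
    ((𝓡∂ 2).interior M).Nonempty := by
  obtain ⟨q⟩ := ‹Nonempty M›
  obtain ⟨U, hU, O, hO, -, hUO⟩ := exists_nhds_preconnected_interior q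
  exact (closure_nonempty_iff.1 ⟨q, hUO (mem_of_mem_nhds hU)⟩).mono hO

theorem IsLambdaTranslator.inner_le_of_height_const [IsManifold (𝓡∂ 2) 2 M] [Nonempty M]
    {lam : ℝ} {v w : E3} {ψ N : M → E3} (hM : IsLambdaTranslator lam w ψ N) (hlam : 0 ≤ lam)
    (hv : ‖v‖ = 1) {m : ℝ} (hconst : ∀ q, inner ℝ (ψ q) v = m) : inner ℝ v w ≤ lam := by
  obtain ⟨p, hp⟩ := interior_nonempty (M := M)
  obtain ⟨b, -, hb⟩ := hM.exists_frame_of_isLocalMax hp (F := fun x => inner ℝ x v)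
    (G := fun _ => v) (A := 0)
    (fun x => by simpa [real_inner_comm] using! (innerSL ℝ v).hasFDerivAt (x := x))
    -- A constant height is maximal everywhere, so the test gives `⟪v, w⟫ + lam ⟪v, N⟫ ≤ 0`, where
    -- `⟪v, N⟫ ≥ -1`.
    (hasFDerivAt_const _ _) (Eventually.of_forall fun q => by simp [hconst])
  have hvN := (abs_le.1 (abs_real_inner_le_norm v (N p))).1
  rw [hv, hM.norm_normal] at hvN
  simp at hb
  nlinarith

theorem IsLambdaTranslator.height_eq_of_isMax [IsManifold (𝓡∂ 2) 2 M] [T2Space M]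
    [CompactSpace M] [PreconnectedSpace M] {lam : ℝ} {v w : E3}
    {ψ N : M → E3} (hM : IsLambdaTranslator lam w ψ N) (hlam : 0 ≤ lam) (hv : ‖v‖ = 1)
    (hw : ‖w‖ = 1) (hvw : lam ≤ inner ℝ v w) {p : M} (hp : (𝓡∂ 2).IsInteriorPoint p) {m : ℝ}
    (hpm : inner ℝ (ψ p) v = m) (hle : ∀ q, inner ℝ (ψ q) v ≤ m) (q : M) :
    inner ℝ (ψ q) v = m := by
  have hfc : Continuous fun q => (inner ℝ (ψ q) v : ℝ) :=
    hM.contMDiff.continuous.inner continuous_const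
  have := eq_univ_of_isClosed_of_forall_interior_mem_nhds
    (Z := {q | (inner ℝ (ψ q) v : ℝ) = m}) (isClosed_eq hfc continuous_const)
    (fun q hq hqi => hM.eventually_height_eq hlam hv hw hvw hqi hq hle) ⟨p, hpm, hp⟩
  exact this.ge (mem_univ q)

theorem IsLambdaTranslator.height_nonpos_and_contact_iff [IsManifold (𝓡∂ 2) 2 M] [T2Space M]
    [CompactSpace M] [ConnectedSpace M] {lam : ℝ} {v w : E3} {ψ N : M → E3}
    (hM : IsLambdaTranslator lam w ψ N) (hlam : 0 ≤ lam) (hv : ‖v‖ = 1) (hw : ‖w‖ = 1)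
    (hvw : lam ≤ inner ℝ v w) (hbdry : ψ '' (𝓡∂ 2).boundary M ⊆ planeOrtho v) :
    (∀ q, inner ℝ (ψ q) v ≤ 0) ∧
      ((ψ '' (𝓡∂ 2).interior M ∩ planeOrtho v).Nonempty ↔
        IsPlanar (range ψ) ∧ |inner ℝ v w| = lam) := by
  have hS := hM.toIsOrientedImmersedSurface
  have hv0 : v ≠ 0 := by
    rw [← norm_ne_zero_iff, hv]; exact one_ne_zero
  have hle : ∀ q, (inner ℝ (ψ q) v : ℝ) ≤ 0 := by
    obtain ⟨p, -, hpmax⟩ := isCompact_univ.exists_isMaxOn univ_nonempty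
      (f := fun q => (inner ℝ (ψ q) v : ℝ))
      (hS.contMDiff.continuous.inner continuous_const).continuousOn
    have hp0 : (inner ℝ (ψ p) v : ℝ) = 0 := by
      rcases (𝓡∂ 2).isInteriorPoint_or_isBoundaryPoint p with hp | hp
      · exact hS.height_eq_zero_of_const hv0 hbdry
          (hM.height_eq_of_isMax hlam hv hw hvw hp rfl fun q => hpmax (mem_univ q))
      · exact hbdry ⟨p, hp, rfl⟩
    exact fun q => hp0 ▸ hpmax (mem_univ q)
  refine ⟨hle, ?_, ?_⟩
  · rintro ⟨_, ⟨p, hp, rfl⟩, hpv⟩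
    have hzero := hM.height_eq_of_isMax hlam hv hw hvw hp hpv hle
    refine ⟨isPlanar_of_forall_inner_eq_zero hv0 (by rintro _ ⟨q, rfl⟩; exact hzero q), ?_⟩
    rw [abs_of_nonneg (hlam.trans hvw)]
    exact le_antisymm (hM.inner_le_of_height_const hlam hv hzero) hvw
  · rintro ⟨hP, -⟩
    obtain ⟨p, hp⟩ := interior_nonempty (M := M)
    exact ⟨ψ p, ⟨p, hp, rfl⟩, hS.height_eq_zero_of_isPlanar hv0 hbdry hP p⟩

end Surface

/-! ### Reduction to `⟪v, w⟫ ≥ 0` -/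

theorem planeOrtho_neg (v : E3) : planeOrtho (-v) = planeOrtho v := by
  ext x
  simp [planeOrtho]

theorem corollary4p4
    {M : Type*} [TopologicalSpace M] [T2Space M] [CompactSpace M] [ConnectedSpace M]
    [ChartedSpace (EuclideanHalfSpace 2) M] [IsManifold (𝓡∂ 2) 2 M]
    (lam : ℝ) (hlam0 : 0 ≤ lam) (hlam1 : lam ≤ 1)
    (v w : E3) (hv : ‖v‖ = 1) (hw : ‖w‖ = 1)
    (ψ N : M → E3) (hM : IsLambdaTranslator lam w ψ N)
    (hbdry : ψ '' (𝓡∂ 2).boundary M ⊆ planeOrtho v)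
    (hvw : lam ≤ |inner ℝ v w|) :
    ψ '' (𝓡∂ 2).interior M ⊆ {x : E3 | Real.sign (inner ℝ v w) * inner ℝ x v ≤ 0} ∧
      ((ψ '' (𝓡∂ 2).interior M ∩ planeOrtho v).Nonempty ↔
        IsPlanar (Set.range ψ) ∧ |inner ℝ v w| = lam) := by
  rcases le_or_gt 0 (inner ℝ v w : ℝ) with hc | hc
  · rw [abs_of_nonneg hc] at hvw
    obtain ⟨hle, hiff⟩ := hM.height_nonpos_and_contact_iff hlam0 hv hw hvw hbdry
    refine ⟨?_, hiff⟩
    rintro _ ⟨q, -, rfl⟩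
    exact mul_nonpos_of_nonneg_of_nonpos
      (hc.eq_or_lt.elim (fun h => by rw [← h, Real.sign_zero])
        fun h => by rw [Real.sign_of_pos h]; exact zero_le_one) (hle q)
  · rw [abs_of_neg hc, ← inner_neg_left] at hvw
    obtain ⟨hle, hiff⟩ := hM.height_nonpos_and_contact_iff hlam0 (by rwa [norm_neg]) hw hvw
      (by rwa [planeOrtho_neg])
    rw [planeOrtho_neg, inner_neg_left, abs_neg] at hiff
    refine ⟨?_, hiff⟩
    rintro _ ⟨q, -, rfl⟩
    have := hle q
    rw [inner_neg_right] at this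
    rw [mem_ofPred_eq, Real.sign_of_neg hc]
    linarith
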